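/- Let $\mathcal G=(V,E)$ be a finite connected undirected (simple) graph with $n$ nodes and $m$ edges, with an arbitrary orientation of its edges and the corresponding $n\times m$ oriented incidence matrix $B$, and let $r$ be the common dimension of the node and edge variables. To each node $i$ there are attached a symmetric positive definite inertia matrix $M_i\in\mathbb R^{r\times r}$, a symmetric positive semidefinite damping matrix $R_i\in\mathbb R^{r\times r}$ and a constant external input $v_i\in\mathbb R^r$; to each edge $k$ a symmetric positive definite weight matrix $W_k\in\mathbb R^{r\times r}$. Put $\mathbb B=B\otimes I_r$, $\mathbb I_r=\mathbb 1\otimes I_r$ (identity blocks $I_r$ stacked on top of each other, one for each node under consideration), $M=\mathrm{diag}(M_i)$, $R=\mathrm{diag}(R_i)$, $W=\mathrm{diag}(W_k)$, $v=\mathrm{col}(v_i)$. The network $\Sigma\times\Gamma$ is the system $$\begin{pmatrix}\dot p\\ \dot q\end{pmatrix}=\begin{pmatrix}-RM^{-1}&-\mathbb BW\\ \mathbb B^TM^{-1}&0\end{pmatrix}\begin{pmatrix}p\\ q\end{pmatrix}+\begin{pmatrix}I\\0\end{pmatrix}v,\qquad y=M^{-1}p,\qquad t\ge 0,$$ with state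 $(p,q)\in\mathbb R^{rn}\times\mathbb R^{rm}$ and arbitrary initial state. Let $V_d$ be the set of damped nodes ($R_i\succ0$) and $V_u$ the set of undamped or partially undamped nodes ($R_i$ singular), and assume that both sets are non-empty. Split the edges into the set $E^d$ of edges inside $V_d$, the set $E^u$ of edges inside $V_u$ and the set $E^i$ of edges between $V_d$ and $V_u$; correspondingly $$\mathbb B=\begin{pmatrix}\mathbb B_d^d&\mathbb B_d^i&0\\0&\mathbb B_u^i&\mathbb B_u^u\end{pmatrix},\qquad W=\mathrm{diag}(W^d,W^i,W^u),$$ and let $M_u$, $R_u$ be the diagonal blocks of $M$, $R$ that belong to $V_u$. Put $$\mathbb L_d^d=\mathbb B_d^dW^d(\mathbb B_d^d)^T,\quad \mathbb L_d^i=\mathbb B_d^iW^i(\mathbb B_d^i)^T,\quad \mathbb L_i^i=\mathbb B_d^iW^i(\mathbb B_u^i)^T,\quad \mathbb L_u^i=\mathbb B_u^iW^i(\mathbb B_u^i)^T,\quad \mathbb L_u^u=\mathbb B_u^uW^u(\mathbb B_u^u)^T,$$ $$\tilde{\mathbb L}_u=(\mathbb L_u^u+\mathbb L_u^i)-(\mathbb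 L_i^i)^T(\mathbb L_d^d+\mathbb L_d^i)^{-1}\mathbb L_i^i,\qquad \hat A=\begin{pmatrix}0&-M_u^{-1}\tilde{\mathbb L}_u\\ I&0\end{pmatrix},\qquad \hat{\hat C}=\begin{pmatrix}\mathbb L_i^i&0\\ R_u&0\\0&\mathbb I_r^TM_u\end{pmatrix}.$$ For a pair $(C,A)$ with $A$ of size $N\times N$, let $\mathrm{Obs}(C,A)=\mathrm{col}(C,CA,\dots,CA^{N-1})$ be its observability matrix. Proposition. All output trajectories $y(t)$ of $\Sigma\times\Gamma$ converge, as $t\to\infty$, to a point of $\mathrm{im}(\mathbb I_r)$ if and only if $\ker(\mathrm{Obs}(\hat{\hat C},\hat A))=\{0\}$, that is, the pair $(\hat{\hat C},\hat A)$ is observable. -/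

import Mathlib

open Filter Topology
open scoped Classical Kronecker

noncomputable section

/-- A network of plants on the nodes and controllers on the edges of a connected undirected graph.
The plant at node `i` is `ṗ_i = -R_i y_i + u_i + v_i`, `y_i = M_i⁻¹ p_i`, the controller on edge `k`
is `q̇_k = z_k`, `f_k = W_k q_k`; all these variables take values in `ℝ^r`.
Every edge gets an (arbitrary) orientation `tail k → head k`. -/
structure Network (V : Type*) (r : ℕ) where
  graph : SimpleGraph V
  connected : graph.Connected
  tail : graph.edgeSet → V
  head : graph.edgeSet → V
  orientation : ∀ k : graph.edgeSet, s(tail k, head k) = (k : Sym2 V)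
  /-- inertia matrices -/
  M : V → Matrix (Fin r) (Fin r) ℝ
  /-- damping matrices -/
  R : V → Matrix (Fin r) (Fin r) ℝ
  /-- edge weight matrices -/
  W : graph.edgeSet → Matrix (Fin r) (Fin r) ℝ
  M_posDef : ∀ i, (M i).PosDef
  R_posSemidef : ∀ i, (R i).PosSemidef
  W_posDef : ∀ k, (W k).PosDef

/-- The block diagonal matrix `diag(D_1, …, D_n)`, indexed by (block, position in the block). -/
def stackDiag {ι : Type*} {r : ℕ} (D : ι → Matrix (Fin r) (Fin r) ℝ) :
    Matrix (ι × Fin r) (ι × Fin r) ℝ :=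
  (Matrix.blockDiagonal D).submatrix Prod.swap Prod.swap

/-- `𝕀_r = 𝟙 ⊗ I_r`, the matrix of identity blocks stacked on top of each other. -/
def stackedId (ι : Type*) (r : ℕ) : Matrix (ι × Fin r) (Fin r) ℝ :=
  Matrix.of fun a j => if a.2 = j then 1 else 0

/-- The observability matrix `col(C, CA, …, CA^(n-1))`, where `n` is the dimension of the state. -/
def obsMatrix {κ ι : Type*} [Fintype ι] (C : Matrix κ ι ℝ) (A : Matrix ι ι ℝ) :
    Matrix (Fin (Fintype.card ι) × κ) ι ℝ :=
  Matrix.of fun a i => (C * A ^ (a.1 : ℕ)) a.2 i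

namespace Network

variable {V : Type*} {r : ℕ}

/-- A node is damped if its damping matrix is positive definite. -/
def IsDamped (N : Network V r) (i : V) : Prop := (N.R i).PosDef

/-- `V_d`. -/
abbrev Vd (N : Network V r) : Type _ := {i : V // N.IsDamped i}

/-- `V_u`: the undamped and partially undamped nodes, i.e. those with a singular `R_i`. -/
abbrev Vu (N : Network V r) : Type _ := {i : V // ¬ N.IsDamped i}

/-- The set of edges. -/
abbrev E (N : Network V r) : Type _ := N.graph.edgeSet

/-- The edges between two damped nodes. -/
abbrev Ed (N : Network V r) : Type _ :=
  {k : N.E // N.IsDamped (N.tail k) ∧ N.IsDamped (N.head k)}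

/-- The edges between a damped and a (partially) undamped node. -/
abbrev Ei (N : Network V r) : Type _ :=
  {k : N.E // ¬ (N.IsDamped (N.tail k) ↔ N.IsDamped (N.head k))}

/-- The edges between two (partially) undamped nodes. -/
abbrev Eu (N : Network V r) : Type _ :=
  {k : N.E // ¬ N.IsDamped (N.tail k) ∧ ¬ N.IsDamped (N.head k)}

/-- The incidence matrix `B` of the oriented graph. -/
def inc (N : Network V r) : Matrix V N.E ℝ :=
  Matrix.of fun i k => (if i = N.head k then 1 else 0) - (if i = N.tail k then 1 else 0)

/-- `𝔹 = B ⊗ I_r`. -/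
def BB (N : Network V r) : Matrix (V × Fin r) (N.E × Fin r) ℝ :=
  N.inc ⊗ₖ (1 : Matrix (Fin r) (Fin r) ℝ)

/-! The nonzero blocks of `𝔹`, by the classes of nodes (rows) and edges (columns). -/

def Bdd (N : Network V r) : Matrix (N.Vd × Fin r) (N.Ed × Fin r) ℝ :=
  N.inc.submatrix Subtype.val Subtype.val ⊗ₖ (1 : Matrix (Fin r) (Fin r) ℝ)

def Bdi (N : Network V r) : Matrix (N.Vd × Fin r) (N.Ei × Fin r) ℝ :=
  N.inc.submatrix Subtype.val Subtype.val ⊗ₖ (1 : Matrix (Fin r) (Fin r) ℝ)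

def Bui (N : Network V r) : Matrix (N.Vu × Fin r) (N.Ei × Fin r) ℝ :=
  N.inc.submatrix Subtype.val Subtype.val ⊗ₖ (1 : Matrix (Fin r) (Fin r) ℝ)

def Buu (N : Network V r) : Matrix (N.Vu × Fin r) (N.Eu × Fin r) ℝ :=
  N.inc.submatrix Subtype.val Subtype.val ⊗ₖ (1 : Matrix (Fin r) (Fin r) ℝ)

/-! The block diagonal parameter matrices. -/

def MM (N : Network V r) : Matrix (V × Fin r) (V × Fin r) ℝ := stackDiag N.M

def RR (N : Network V r) : Matrix (V × Fin r) (V × Fin r) ℝ := stackDiag N.R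

def WW (N : Network V r) : Matrix (N.E × Fin r) (N.E × Fin r) ℝ := stackDiag N.W

def Mu (N : Network V r) : Matrix (N.Vu × Fin r) (N.Vu × Fin r) ℝ :=
  stackDiag fun i : N.Vu => N.M i

def Ru (N : Network V r) : Matrix (N.Vu × Fin r) (N.Vu × Fin r) ℝ :=
  stackDiag fun i : N.Vu => N.R i

def Wd (N : Network V r) : Matrix (N.Ed × Fin r) (N.Ed × Fin r) ℝ :=
  stackDiag fun k : N.Ed => N.W k

def Wi (N : Network V r) : Matrix (N.Ei × Fin r) (N.Ei × Fin r) ℝ :=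
  stackDiag fun k : N.Ei => N.W k

def Wu (N : Network V r) : Matrix (N.Eu × Fin r) (N.Eu × Fin r) ℝ :=
  stackDiag fun k : N.Eu => N.W k

variable [Fintype V]

/-! The closed-loop system `ż = A z + G v`, `y = (M⁻¹ 0) z`, with `z = col(p, q)`. -/

/-- The state matrix `A` of the closed loop. -/
def sysA (N : Network V r) :
    Matrix ((V × Fin r) ⊕ (N.E × Fin r)) ((V × Fin r) ⊕ (N.E × Fin r)) ℝ :=
  Matrix.fromBlocks (-(N.RR * N.MM⁻¹)) (-(N.BB * N.WW)) (N.BB.transpose * N.MM⁻¹) 0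

/-- The input matrix `G = col(I, 0)` of the closed loop. -/
def sysG (N : Network V r) : Matrix ((V × Fin r) ⊕ (N.E × Fin r)) (V × Fin r) ℝ :=
  Matrix.fromRows 1 0

/-- The output matrix `(M⁻¹ 0)` of the closed loop. -/
def sysC (N : Network V r) : Matrix (V × Fin r) ((V × Fin r) ⊕ (N.E × Fin r)) ℝ :=
  Matrix.fromCols N.MM⁻¹ 0

/-- `z : [0, ∞) → ℝ^(r(n+m))` is a state trajectory of the closed loop with constant external
input `v`. The initial state is arbitrary. -/
def IsTrajectory (N : Network V r) (v : V × Fin r → ℝ)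
    (z : ℝ → (V × Fin r) ⊕ (N.E × Fin r) → ℝ) : Prop :=
  ∀ t : ℝ, 0 ≤ t →
    HasDerivWithinAt z (N.sysA.mulVec (z t) + N.sysG.mulVec v) (Set.Ici 0) t

/-- Every output trajectory converges to a point of `im 𝕀_r` as `t → ∞`. -/
def OutputConsensus (N : Network V r) (v : V × Fin r → ℝ) : Prop :=
  ∀ z : ℝ → (V × Fin r) ⊕ (N.E × Fin r) → ℝ, N.IsTrajectory v z →
    ∃ y₀ ∈ LinearMap.range (stackedId V r).mulVecLin,
      Tendsto (fun t => N.sysC.mulVec (z t)) atTop (𝓝 y₀)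

/-! The blocks of the Laplacian `𝔹 W 𝔹ᵀ`. -/

def Ldd (N : Network V r) : Matrix (N.Vd × Fin r) (N.Vd × Fin r) ℝ :=
  N.Bdd * N.Wd * N.Bdd.transpose

/-- `L_d^i`. -/
def Ldi (N : Network V r) : Matrix (N.Vd × Fin r) (N.Vd × Fin r) ℝ :=
  N.Bdi * N.Wi * N.Bdi.transpose

/-- `L_i^i`. -/
def Lii (N : Network V r) : Matrix (N.Vd × Fin r) (N.Vu × Fin r) ℝ :=
  N.Bdi * N.Wi * N.Bui.transpose

/-- `L_u^i`. -/
def Lui (N : Network V r) : Matrix (N.Vu × Fin r) (N.Vu × Fin r) ℝ :=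
  N.Bui * N.Wi * N.Bui.transpose

def Luu (N : Network V r) : Matrix (N.Vu × Fin r) (N.Vu × Fin r) ℝ :=
  N.Buu * N.Wu * N.Buu.transpose

/-- The Laplacian `L̃_u` of the graph reduced to the (partially) undamped nodes: the Schur
complement `(L_u^u + L_u^i) - (L_i^i)ᵀ (L_d^d + L_d^i)⁻¹ L_i^i`. -/
def Lred (N : Network V r) : Matrix (N.Vu × Fin r) (N.Vu × Fin r) ℝ :=
  (N.Luu + N.Lui) - N.Lii.transpose * (N.Ldd + N.Ldi)⁻¹ * N.Lii

/-- `Â`, acting on `col(y_u, s_u)`. -/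
def Ahat (N : Network V r) :
    Matrix ((N.Vu × Fin r) ⊕ (N.Vu × Fin r)) ((N.Vu × Fin r) ⊕ (N.Vu × Fin r)) ℝ :=
  Matrix.fromBlocks 0 (-(N.Mu⁻¹ * N.Lred)) 1 0

/-- The output matrix with block rows `(L_i^i 0)`, `(R_u 0)` and `(0 𝕀_rᵀ M_u)`. -/
def Chathat (N : Network V r) :
    Matrix ((N.Vd × Fin r) ⊕ ((N.Vu × Fin r) ⊕ Fin r)) ((N.Vu × Fin r) ⊕ (N.Vu × Fin r)) ℝ :=
  Matrix.fromRows (Matrix.fromCols N.Lii 0)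
    (Matrix.fromRows (Matrix.fromCols N.Ru 0)
      (Matrix.fromCols 0 ((stackedId N.Vu r).transpose * N.Mu)))

end Network

end

/-! Shifting by an equilibrium, whose output is already a consensus value (`exists_equilibrium`),
turns trajectories into orbits of exp(tA). The energy pᵀM⁻¹p + qᵀWq decays at rate 2yᵀRy, so
LaSalle's principle (`tendsto_output_zero`) reduces consensus to a static condition: every state w
with R C Aᵏ w = 0 for all k has zero output (`outputConsensus_iff`).

Along such an undissipated motion the damped nodes stand still, and Mÿ = -Ly with L = 𝔹W𝔹ᵀ splits
into L_i^i y_u = 0 and M_u ÿ_u = -L̃_u y_u; moreover R_u y_u = 0. This is the reduced dynamics with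
vanishing output. The static condition is compared with observability through two maps that
intertwine A and Â: `liftState` makes an undissipated state with output y_u from an unobservable
(y_u, s_u), and `reducedState` sends an undissipated w to the unobservable pair (ÿ_u, ẏ_u). The row
𝕀_rᵀM_u excludes the uniform displacements s_u, which L̃_u annihilates and which produce no motion.
-/

noncomputable section

/-! ### Linear flows, quadratic Lyapunov functions and LaSalle's principle -/

section LinearFlow

variable {E F : Type*} [NormedAddCommGroup E] [NormedSpace ℝ E] [NormedAddCommGroup F]
  [NormedSpace ℝ F]

/-- The flow `exp (t A)` of the linear equation `ẋ = A x`. -/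
def linearFlow (A : E →L[ℝ] E) (t : ℝ) : E →L[ℝ] E := NormedSpace.exp (t • A)

theorem linearFlow_zero (A : E →L[ℝ] E) (x : E) : linearFlow A 0 x = x := by
  simp [linearFlow, NormedSpace.exp_zero]

theorem linearFlow_add [CompleteSpace E] (A : E →L[ℝ] E) (s t : ℝ) (x : E) :
    linearFlow A (s + t) x = linearFlow A s (linearFlow A t x) := by
  have : NormedAlgebra ℚ (E →L[ℝ] E) := NormedAlgebra.restrictScalars ℚ ℝ _
  unfold linearFlow
  rw [add_smul, NormedSpace.exp_add_of_commute]
  · rfl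
  · exact ((Commute.refl A).smul_left s).smul_right t

theorem hasDerivAt_linearFlow [CompleteSpace E] (A : E →L[ℝ] E) (x : E) (t : ℝ) :
    HasDerivAt (fun t => linearFlow A t x) (A (linearFlow A t x)) t :=
  (hasDerivAt_exp_smul_const' A t).clm_apply (hasDerivAt_const t x) |>.congr_deriv (by
    simp [linearFlow])

theorem hasDerivAt_linearFlow' [CompleteSpace E] (A : E →L[ℝ] E) (x : E) (t : ℝ) :
    HasDerivAt (fun t => linearFlow A t x) (linearFlow A t (A x)) t :=
  (hasDerivAt_exp_smul_const A t).clm_apply (hasDerivAt_const t x) |>.congr_deriv (by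
    simp [linearFlow])

theorem eq_linearFlow_of_hasDerivWithinAt [CompleteSpace E] (A : E →L[ℝ] E) {z : ℝ → E}
    (hz : ∀ t, 0 ≤ t → HasDerivWithinAt z (A (z t)) (Set.Ici 0) t) {t : ℝ} (ht : 0 ≤ t) :
    z t = linearFlow A t (z 0) := by
  refine ODE_solution_unique (v := fun _ x => A x) (g := fun t => linearFlow A t (z 0))
    (K := ‖A‖₊) (a := 0) (b := t)
    (fun _ => A.lipschitz) (fun s hs => ?_) (fun s hs => (hz s hs.1).mono
      (Set.Ici_subset_Ici.2 hs.1)) (fun s _ => ?_) (fun s _ => ?_) ?_ ⟨ht, le_rfl⟩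
  · exact (hz s hs.1).continuousWithinAt.mono Set.Icc_subset_Ici_self
  · exact (hasDerivAt_linearFlow A (z 0) s).continuousAt.continuousWithinAt
  · exact (hasDerivAt_linearFlow A (z 0) s).hasDerivWithinAt
  · exact (linearFlow_zero A _).symm

/-- Apply D to the exponential series term by term. -/
theorem map_linearFlow_eq_zero [CompleteSpace E] (A : E →L[ℝ] E) (D : E →L[ℝ] F) {x : E}
    (hx : ∀ k : ℕ, D ((A ^ k) x) = 0) (t : ℝ) : D (linearFlow A t x) = 0 := by
  have h := NormedSpace.exp_series_hasSum_exp' (𝕂 := ℝ) (t • A)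
  have h2 := ((ContinuousLinearMap.apply ℝ E x).hasSum h).mapL D
  refine h2.unique ?_
  convert hasSum_zero with k
  rw [ContinuousLinearMap.apply_apply, smul_pow]
  simp only [smul_apply, map_smul, hx k, smul_zero]

/-- Differentiate D exp(tA)x = 0 repeatedly and evaluate at t = 0; derivatives within [0, ∞) are
unique there too. -/
theorem map_pow_eq_zero_of_map_linearFlow [CompleteSpace E] (A : E →L[ℝ] E) (D : E →L[ℝ] F)
    {x : E} (hx : ∀ t : ℝ, 0 ≤ t → D (linearFlow A t x) = 0) (k : ℕ) : D ((A ^ k) x) = 0 := by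
  have key : ∀ t : ℝ, 0 ≤ t → D (linearFlow A t ((A ^ k) x)) = 0 := by
    induction k with
    | zero => simpa using hx
    | succ k ih =>
      intro t ht
      have h1 : HasDerivWithinAt (fun t => D (linearFlow A t ((A ^ k) x)))
          (D (linearFlow A t (A ((A ^ k) x)))) (Set.Ici 0) t :=
        (D.hasFDerivAt.comp_hasDerivAt t (hasDerivAt_linearFlow' A _ t)).hasDerivWithinAt
      have h2 : HasDerivWithinAt (fun t => D (linearFlow A t ((A ^ k) x))) 0 (Set.Ici 0) t :=
        (hasDerivWithinAt_const t (Set.Ici (0 : ℝ)) (0 : F)).congr (fun s hs => ih s hs) (ih t ht)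
      rw [pow_succ']
      exact (uniqueDiffOn_Ici (0 : ℝ) t ht).eq_deriv _ h1 h2
  simpa [linearFlow_zero] using key 0 le_rfl

/-- The quadratic form of `B` is a Lyapunov function of `ẋ = A x` that is dissipated exactly
where the output `D x` does not vanish. -/
structure IsLyapunovForm (A : E →L[ℝ] E) (B : E →L[ℝ] E →L[ℝ] ℝ) (D : E →L[ℝ] F) : Prop where
  symm : ∀ x y, B x y = B y x
  pos : ∀ x, x ≠ 0 → 0 < B x x
  nonpos : ∀ x, B x (A x) ≤ 0
  eq_zero_iff : ∀ x, B x (A x) = 0 ↔ D x = 0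

namespace IsLyapunovForm

variable {A : E →L[ℝ] E} {B : E →L[ℝ] E →L[ℝ] ℝ} {D : E →L[ℝ] F}

theorem nonneg (h : IsLyapunovForm A B D) (x : E) : 0 ≤ B x x := by
  by_cases hx : x = 0
  · simp [hx]
  · exact (h.pos x hx).le

theorem hasDerivAt [CompleteSpace E] (h : IsLyapunovForm A B D) (x : E) (t : ℝ) :
    HasDerivAt (fun t => B (linearFlow A t x) (linearFlow A t x))
      (2 * B (linearFlow A t x) (A (linearFlow A t x))) t := by
  have h1 := hasDerivAt_linearFlow A x t
  refine ((B.hasFDerivAt.comp_hasDerivAt t h1).clm_apply h1).congr_deriv ?_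
  simp only [Function.comp_apply]
  rw [h.symm]
  ring

theorem antitone [CompleteSpace E] (h : IsLyapunovForm A B D) (x : E) :
    Antitone fun t => B (linearFlow A t x) (linearFlow A t x) := by
  refine antitone_of_deriv_nonpos (fun t => (h.hasDerivAt x t).differentiableAt) fun t => ?_
  rw [(h.hasDerivAt x t).deriv]
  linarith [h.nonpos (linearFlow A t x)]

theorem conserved [CompleteSpace E] (h : IsLyapunovForm A B D) {x : E}
    (hx : ∀ k : ℕ, D ((A ^ k) x) = 0) (t : ℝ) :
    B (linearFlow A t x) (linearFlow A t x) = B x x := by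
  have h0 := is_const_of_deriv_eq_zero (fun t => (h.hasDerivAt x t).differentiableAt)
    (fun t => by
      rw [(h.hasDerivAt x t).deriv, (h.eq_zero_iff _).2 (map_linearFlow_eq_zero A D hx t),
        mul_zero]) t 0
  simpa [linearFlow_zero] using h0

theorem exists_coercive [FiniteDimensional ℝ E] (h : IsLyapunovForm A B D) :
    ∃ c > 0, ∀ x, c * ‖x‖ ^ 2 ≤ B x x := by
  have := FiniteDimensional.proper ℝ E
  rcases subsingleton_or_nontrivial E with hE | hE
  · exact ⟨1, one_pos, fun x => by simp [Subsingleton.elim x 0]⟩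
  -- The constant is the minimum of the form on the unit sphere; homogeneity gives the rest.
  obtain ⟨x₀, hx₀, hmin⟩ := (isCompact_sphere (0 : E) 1).exists_isMinOn
    (NormedSpace.sphere_nonempty.2 zero_le_one)
    (f := fun x => B x x) (B.continuous.clm_apply continuous_id).continuousOn
  have hx₀' : x₀ ≠ 0 := by
    rintro rfl
    simp at hx₀
  refine ⟨B x₀ x₀, h.pos _ hx₀', fun x => ?_⟩
  by_cases hx : x = 0
  · simp [hx]
  have hn : 0 < ‖x‖ := norm_pos_iff.2 hx
  have hu : ‖x‖⁻¹ • x ∈ Metric.sphere (0 : E) 1 := by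
    simp [norm_smul, hn.ne']
  have h1 : B x₀ x₀ ≤ B (‖x‖⁻¹ • x) (‖x‖⁻¹ • x) := hmin hu
  simp only [map_smul, smul_apply, smul_eq_mul] at h1
  calc B x₀ x₀ * ‖x‖ ^ 2 ≤ (‖x‖⁻¹ * (‖x‖⁻¹ * B x x)) * ‖x‖ ^ 2 := by gcongr
    _ = B x x := by field_simp

/-- LaSalle's invariance principle: an output vanishing on the states that are unobservable
from `D` tends to zero along the flow. -/
theorem tendsto_output_zero [FiniteDimensional ℝ E] (h : IsLyapunovForm A B D)
    {G : Type*} [NormedAddCommGroup G] [NormedSpace ℝ G] (C : E →L[ℝ] G)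
    (hC : ∀ x, (∀ k : ℕ, D ((A ^ k) x) = 0) → C x = 0) (x : E) :
    Tendsto (fun t => C (linearFlow A t x)) atTop (𝓝 0) := by
  have hprop := FiniteDimensional.proper ℝ E
  have hcomp := FiniteDimensional.complete ℝ E
  obtain ⟨c, hc, hcoer⟩ := h.exists_coercive
  set H : E → ℝ := fun x => B x x with hH
  have hHc : Continuous H := B.continuous.clm_apply continuous_id
  have hlim := tendsto_atTop_ciInf (h.antitone x) ⟨0, by rintro _ ⟨t, rfl⟩; exact h.nonneg _⟩
  refine tendsto_of_subseq_tendsto fun u hu => ?_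
  -- At times t ≥ 0 the energy is at most H x, and coercivity turns this into a norm bound.
  have hbd : ∀ᶠ n in atTop, linearFlow A (u n) x ∈ Metric.closedBall (0 : E) √(H x / c) := by
    filter_upwards [hu.eventually_ge_atTop 0] with n hn
    rw [mem_closedBall_zero_iff]
    apply Real.le_sqrt_of_sq_le
    rw [le_div_iff₀ hc, mul_comm]
    refine (hcoer _).trans ?_
    simpa [linearFlow_zero] using h.antitone x hn
  obtain ⟨w, -, φ, hφ, hw⟩ :=
    tendsto_subseq_of_frequently_bounded Metric.isBounded_closedBall hbd.frequently
  refine ⟨φ, ?_⟩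
  suffices hw0 : C w = 0 by
    rw [← hw0]
    exact (C.continuous.tendsto w).comp hw
  have huφ : Tendsto (fun n => u (φ n)) atTop atTop := hu.comp hφ.tendsto_atTop
  -- The orbit of the limit point w consists of limits of the original orbit at the times s + u (φ
  -- n), where the energy tends to its infimum.
  have hconst : ∀ s : ℝ, H (linearFlow A s w) = ⨅ t, H (linearFlow A t x) := by
    intro s
    have h1 : Tendsto (fun n => H (linearFlow A (s + u (φ n)) x)) atTop
        (𝓝 (H (linearFlow A s w))) := by
      simp only [linearFlow_add]
      exact ((hHc.comp (linearFlow A s).continuous).tendsto w).comp hw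
    exact tendsto_nhds_unique h1 (hlim.comp (tendsto_atTop_add_const_left _ s huφ))
  -- Constant energy along the orbit of w means no dissipation, so w is unobservable from D.
  refine hC w (map_pow_eq_zero_of_map_linearFlow A D fun t _ => (h.eq_zero_iff _).1 ?_)
  have h2 : HasDerivAt (fun t => B (linearFlow A t w) (linearFlow A t w)) 0 t := by
    have : (fun t => B (linearFlow A t w) (linearFlow A t w)) =
      fun _ => ⨅ t, H (linearFlow A t x) := funext hconst
    rw [this]
    exact hasDerivAt_const _ _
  linarith [(h.hasDerivAt w t).unique h2]

end IsLyapunovForm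

end LinearFlow

/-! ### Observability matrices -/

/-- Cayley–Hamilton: Aᵏ is the value at A of Xᵏ modulo the characteristic polynomial. Dimension zero
is separate because that polynomial is then 1 and the remainder has no smaller degree. -/
theorem mulVec_pow_eq_zero_of_lt_card {κ ι : Type*} [Fintype ι] (C : Matrix κ ι ℝ)
    (A : Matrix ι ι ℝ) {x : ι → ℝ} (hx : ∀ k < Fintype.card ι, C.mulVec ((A ^ k).mulVec x) = 0)
    (k : ℕ) : C.mulVec ((A ^ k).mulVec x) = 0 := by
  cases isEmpty_or_nonempty ι with
  | inl hι => rw [Subsingleton.elim ((A ^ k).mulVec x) 0, Matrix.mulVec_zero]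
  | inr hι =>
    have hdeg : (Polynomial.X ^ k %ₘ A.charpoly).natDegree < Fintype.card ι := by
      have h1 := Polynomial.natDegree_modByMonic_lt (Polynomial.X ^ k : Polynomial ℝ)
        (Matrix.charpoly_monic A) (fun h => by
          have := Matrix.charpoly_natDegree_eq_dim A
          rw [h, Polynomial.natDegree_one] at this
          exact Fintype.card_ne_zero this.symm)
      rwa [Matrix.charpoly_natDegree_eq_dim A] at h1
    rw [Matrix.pow_eq_aeval_mod_charpoly, Polynomial.aeval_eq_sum_range, Matrix.sum_mulVec,
      Matrix.mulVec_sum]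
    refine Finset.sum_eq_zero fun i hi => ?_
    rw [Matrix.smul_mulVec, Matrix.mulVec_smul, hx i (by
      have := Finset.mem_range.1 hi; omega), smul_zero]

theorem ker_obsMatrix_eq_bot_iff {κ ι : Type*} [Fintype ι] [hdec : DecidableEq ι]
    (C : Matrix κ ι ℝ) (A : Matrix ι ι ℝ) : LinearMap.ker (obsMatrix C A).mulVecLin = ⊥ ↔
      ∀ x : ι → ℝ, (∀ k : ℕ, C.mulVec ((A ^ k).mulVec x) = 0) → x = 0 := by
  -- `obsMatrix` takes its powers with the classical instance; the given one is identified with it.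
  obtain rfl : hdec = fun a b => Classical.propDecidable (a = b) := Subsingleton.elim _ _
  have key : ∀ x : ι → ℝ, (obsMatrix C A).mulVec x = 0 ↔
      ∀ k : ℕ, C.mulVec ((A ^ k).mulVec x) = 0 := by
    intro x
    have h : ∀ a, (obsMatrix C A).mulVec x a = C.mulVec ((A ^ (a.1 : ℕ)).mulVec x) a.2 := by
      intro a
      rw [Matrix.mulVec_mulVec]
      rfl
    constructor
    · intro hx
      refine mulVec_pow_eq_zero_of_lt_card C A fun k hk => ?_
      ext j
      exact (h (⟨k, hk⟩, j)).symm.trans (congrFun hx _)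
    · intro hx
      ext a
      rw [h, hx]
      rfl
  rw [LinearMap.ker_eq_bot']
  exact forall_congr' fun x => by rw [Matrix.mulVecLin_apply, key]

/-! ### Block diagonal, positive definite and stacked identity matrices -/

section StackDiag

variable {ι : Type*} {r : ℕ}

theorem stackDiag_apply (D : ι → Matrix (Fin r) (Fin r) ℝ) (x y : ι × Fin r) :
    stackDiag D x y = if x.1 = y.1 then D x.1 x.2 y.2 else 0 := by
  simp [stackDiag, Matrix.blockDiagonal_apply]

theorem stackDiag_isHermitian {D : ι → Matrix (Fin r) (Fin r) ℝ} (hD : ∀ i, (D i).IsHermitian) :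
    (stackDiag D).IsHermitian := by
  ext x y
  rw [Matrix.conjTranspose_apply, stackDiag_apply, stackDiag_apply]
  by_cases h : x.1 = y.1
  · rw [if_pos h, if_pos h.symm, h]
    exact (hD y.1).apply _ _
  · rw [if_neg h, if_neg (Ne.symm h), star_zero]

variable [Fintype ι]

theorem stackDiag_mulVec (D : ι → Matrix (Fin r) (Fin r) ℝ) (x : ι × Fin r → ℝ) (i : ι)
    (a : Fin r) : (stackDiag D).mulVec x (i, a) = (D i).mulVec (fun b => x (i, b)) a := by
  simp only [Matrix.mulVec, dotProduct, stackDiag_apply, Fintype.sum_prod_type, ite_mul, zero_mul]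
  rw [Finset.sum_eq_single i (fun j _ hj => by simp [hj.symm]) (by simp)]
  simp

theorem dotProduct_stackDiag_mulVec (D : ι → Matrix (Fin r) (Fin r) ℝ) (x y : ι × Fin r → ℝ) :
    x ⬝ᵥ (stackDiag D).mulVec y =
      ∑ i, (fun a => x (i, a)) ⬝ᵥ (D i).mulVec (fun a => y (i, a)) := by
  simp only [dotProduct, Fintype.sum_prod_type, stackDiag_mulVec]

theorem stackDiag_posSemidef {D : ι → Matrix (Fin r) (Fin r) ℝ} (hD : ∀ i, (D i).PosSemidef) :
    (stackDiag D).PosSemidef := by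
  refine Matrix.PosSemidef.of_dotProduct_mulVec_nonneg
    (stackDiag_isHermitian fun i => (hD i).isHermitian) fun x => ?_
  rw [star_trivial, dotProduct_stackDiag_mulVec]
  exact Finset.sum_nonneg fun i _ => by
    simpa using (hD i).dotProduct_mulVec_nonneg fun a => x (i, a)

theorem stackDiag_posDef {D : ι → Matrix (Fin r) (Fin r) ℝ} (hD : ∀ i, (D i).PosDef) :
    (stackDiag D).PosDef := by
  refine Matrix.PosDef.of_dotProduct_mulVec_pos
    (stackDiag_isHermitian fun i => (hD i).isHermitian) fun x hx => ?_
  rw [star_trivial, dotProduct_stackDiag_mulVec]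
  obtain ⟨⟨i, a⟩, hi⟩ := Function.ne_iff.1 hx
  refine Finset.sum_pos' (fun i _ => by
    simpa using (hD i).posSemidef.dotProduct_mulVec_nonneg fun a => x (i, a))
    ⟨i, Finset.mem_univ _, ?_⟩
  have hne : (fun a => x (i, a)) ≠ 0 := Function.ne_iff.2 ⟨a, hi⟩
  simpa using (hD i).dotProduct_mulVec_pos hne

end StackDiag

theorem stackedId_mulVec (ι : Type*) {r : ℕ} (c : Fin r → ℝ) (x : ι × Fin r) :
    (stackedId ι r).mulVec c x = c x.2 := by
  simp [stackedId, Matrix.mulVec, dotProduct]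

theorem stackedId_transpose_mulVec {ι : Type*} [Fintype ι] {r : ℕ} (x : ι × Fin r → ℝ)
    (a : Fin r) : (stackedId ι r).transpose.mulVec x a = ∑ i, x (i, a) := by
  simp [stackedId, Matrix.mulVec, dotProduct, Fintype.sum_prod_type]

theorem mem_range_stackedId {ι : Type*} [Nonempty ι] {r : ℕ} {y : ι × Fin r → ℝ} :
    y ∈ LinearMap.range (stackedId ι r).mulVecLin ↔ ∀ i j a, y (i, a) = y (j, a) := by
  constructor
  · rintro ⟨c, rfl⟩ i j a
    simp [stackedId_mulVec]
  · intro h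
    obtain ⟨i⟩ := ‹Nonempty ι›
    refine ⟨fun a => y (i, a), ?_⟩
    ext ⟨j, a⟩
    rw [Matrix.mulVecLin_apply, stackedId_mulVec, h i j]

theorem Matrix.mulVec_mulVec_inv {n : Type*} [Fintype n] [DecidableEq n] {M : Matrix n n ℝ}
    (hM : M.PosDef) (x : n → ℝ) : M.mulVec (M⁻¹.mulVec x) = x := by
  rw [Matrix.mulVec_mulVec, Matrix.mul_nonsing_inv _ ((Matrix.isUnit_iff_isUnit_det _).1 hM.isUnit),
    Matrix.one_mulVec]

theorem Matrix.inv_mulVec_mulVec {n : Type*} [Fintype n] [DecidableEq n] {M : Matrix n n ℝ}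
    (hM : M.PosDef) (x : n → ℝ) : M⁻¹.mulVec (M.mulVec x) = x := by
  rw [Matrix.mulVec_mulVec, Matrix.nonsing_inv_mul _ ((Matrix.isUnit_iff_isUnit_det _).1 hM.isUnit),
    Matrix.one_mulVec]

theorem Matrix.PosDef.mulVec_eq_zero_iff {n : Type*} [Fintype n] {M : Matrix n n ℝ}
    (hM : M.PosDef) {x : n → ℝ} : M.mulVec x = 0 ↔ x = 0 := by
  refine ⟨fun h => ?_, fun h => by rw [h, Matrix.mulVec_zero]⟩
  rw [← Matrix.inv_mulVec_mulVec hM x, h, Matrix.mulVec_zero]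

theorem Matrix.PosSemidef.dotProduct_mulVec_eq_zero_iff {n : Type*} [Fintype n]
    {M : Matrix n n ℝ} (hM : M.PosSemidef) {x : n → ℝ} :
    x ⬝ᵥ M.mulVec x = 0 ↔ M.mulVec x = 0 := by
  simpa using hM.dotProduct_mulVec_zero_iff x

theorem Matrix.IsHermitian.dotProduct_mulVec_comm {n : Type*} [Fintype n] {M : Matrix n n ℝ}
    (hM : M.IsHermitian) (x y : n → ℝ) : x ⬝ᵥ M.mulVec y = y ⬝ᵥ M.mulVec x := by
  have h : M.transpose = M := hM
  rw [Matrix.dotProduct_mulVec, ← Matrix.mulVec_transpose, h, dotProduct_comm]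

/-- An affine equation `A z + b = 0` is solvable if `b` is orthogonal to the left kernel of `A`. -/
theorem Matrix.exists_mulVec_add_eq_zero {m n : Type*} [Fintype m] [Fintype n]
    (A : Matrix m n ℝ) (b : m → ℝ) (h : ∀ u : m → ℝ, A.transpose.mulVec u = 0 → u ⬝ᵥ b = 0) :
    ∃ z, A.mulVec z + b = 0 := by
  suffices hb : b ∈ LinearMap.range A.mulVecLin by
    obtain ⟨z, hz⟩ := hb
    exact ⟨-z, by rw [Matrix.mulVec_neg, ← hz, Matrix.mulVecLin_apply, neg_add_cancel]⟩
  by_contra hb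
  -- A functional that vanishes on the range but not at b is u ⬝ᵥ · for some u in the left kernel.
  obtain ⟨f, hf, hle⟩ := Submodule.exists_le_ker_of_notMem hb
  obtain ⟨u, rfl⟩ := (dotProductEquiv ℝ m).surjective f
  refine hf (h u ?_)
  refine dotProduct_eq_zero _ fun w => ?_
  rw [Matrix.mulVec_transpose, ← Matrix.dotProduct_mulVec]
  exact hle ⟨w, rfl⟩

/-! ### The network, its incidence matrix and its energy -/

namespace Network

variable {V : Type*} {r : ℕ} [Fintype V]

theorem MM_posDef (N : Network V r) : N.MM.PosDef := stackDiag_posDef N.M_posDef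

theorem RR_posSemidef (N : Network V r) : N.RR.PosSemidef := stackDiag_posSemidef N.R_posSemidef

theorem WW_posDef (N : Network V r) : N.WW.PosDef := stackDiag_posDef N.W_posDef

theorem Mu_posDef (N : Network V r) : N.Mu.PosDef := stackDiag_posDef fun i => N.M_posDef i

theorem BB_transpose_mulVec (N : Network V r) (x : V × Fin r → ℝ) (k : N.E) (a : Fin r) :
    N.BB.transpose.mulVec x (k, a) = x (N.head k, a) - x (N.tail k, a) := by
  simp [BB, inc, Matrix.mulVec, dotProduct, Fintype.sum_prod_type, Matrix.one_apply, sub_mul,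
    Finset.sum_sub_distrib]

/-- Values agree across each edge, whichever way it is oriented, hence along walks; connectedness
does the rest. -/
theorem BB_transpose_mulVec_eq_zero_iff (N : Network V r) {x : V × Fin r → ℝ} :
    N.BB.transpose.mulVec x = 0 ↔ ∀ i j a, x (i, a) = x (j, a) := by
  constructor
  · intro h
    have hadj : ∀ i j, N.graph.Adj i j → ∀ a, x (i, a) = x (j, a) := by
      intro i j hij a
      set k : N.E := ⟨s(i, j), hij⟩
      have h1 := congrFun h (k, a)
      rw [BB_transpose_mulVec, Pi.zero_apply, sub_eq_zero] at h1
      have h2 : s(N.tail k, N.head k) = s(i, j) := N.orientation k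
      rcases Sym2.eq_iff.1 h2 with ⟨h3, h4⟩ | ⟨h3, h4⟩
      · rw [← h3, ← h4, h1]
      · rw [← h3, ← h4, h1]
    intro i j a
    obtain ⟨p⟩ := N.connected.preconnected i j
    induction p with
    | nil => rfl
    | cons hij _ ih => rw [hadj _ _ hij, ih]
  · intro h
    ext ⟨k, a⟩
    rw [BB_transpose_mulVec, h (N.head k) (N.tail k), sub_self, Pi.zero_apply]

theorem apply_eq_zero_of_RR_mulVec (N : Network V r) {y : V × Fin r → ℝ}
    (h : N.RR.mulVec y = 0) {i : V} (hi : N.IsDamped i) (a : Fin r) : y (i, a) = 0 := by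
  have h1 : (N.R i).mulVec (fun b => y (i, b)) = 0 := by
    ext a
    rw [← stackDiag_mulVec]
    exact congrFun h (i, a)
  exact congrFun (hi.mulVec_eq_zero_iff.1 h1) a

theorem eq_zero_of_BB_transpose_of_apply (N : Network V r) {y : V × Fin r → ℝ}
    (h : N.BB.transpose.mulVec y = 0) {i : V} (hi : ∀ a, y (i, a) = 0) : y = 0 := by
  ext ⟨j, a⟩
  rw [N.BB_transpose_mulVec_eq_zero_iff.1 h j i, hi, Pi.zero_apply]

theorem sysC_mulVec (N : Network V r) (p : V × Fin r → ℝ) (q : N.E × Fin r → ℝ) :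
    N.sysC.mulVec (Sum.elim p q) = N.MM⁻¹.mulVec p := by
  simp [sysC, Matrix.fromCols_mulVec]

theorem sysA_mulVec (N : Network V r) (p : V × Fin r → ℝ) (q : N.E × Fin r → ℝ) :
    N.sysA.mulVec (Sum.elim p q) =
      Sum.elim (-(N.RR.mulVec (N.MM⁻¹.mulVec p)) - N.BB.mulVec (N.WW.mulVec q))
        (N.BB.transpose.mulVec (N.MM⁻¹.mulVec p)) := by
  simp [sysA, Matrix.fromBlocks_mulVec, Matrix.neg_mulVec, Matrix.mulVec_mulVec, sub_eq_add_neg]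

theorem sysG_mulVec (N : Network V r) (v : V × Fin r → ℝ) :
    N.sysG.mulVec v = Sum.elim v 0 := by
  simp [sysG, Matrix.fromRows_mulVec]

/-- The matrix of twice the total energy `pᵀ M⁻¹ p + qᵀ W q`. -/
def energyMatrix (N : Network V r) :
    Matrix ((V × Fin r) ⊕ (N.E × Fin r)) ((V × Fin r) ⊕ (N.E × Fin r)) ℝ :=
  Matrix.fromBlocks N.MM⁻¹ 0 0 N.WW

theorem dotProduct_energyMatrix_mulVec (N : Network V r) (p p' : V × Fin r → ℝ)
    (q q' : N.E × Fin r → ℝ) :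
    Sum.elim p q ⬝ᵥ N.energyMatrix.mulVec (Sum.elim p' q') =
      p ⬝ᵥ N.MM⁻¹.mulVec p' + q ⬝ᵥ N.WW.mulVec q' := by
  simp [energyMatrix, Matrix.fromBlocks_mulVec]

/-- The power exchanged between nodes and edges cancels; only the damping remains. -/
theorem energyMatrix_dissipation (N : Network V r) (p : V × Fin r → ℝ) (q : N.E × Fin r → ℝ) :
    Sum.elim p q ⬝ᵥ N.energyMatrix.mulVec (N.sysA.mulVec (Sum.elim p q)) =
      -(N.MM⁻¹.mulVec p ⬝ᵥ N.RR.mulVec (N.MM⁻¹.mulVec p)) := by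
  rw [sysA_mulVec, dotProduct_energyMatrix_mulVec,
    N.MM_posDef.inv.isHermitian.dotProduct_mulVec_comm,
    N.WW_posDef.isHermitian.dotProduct_mulVec_comm, sub_dotProduct,
    neg_dotProduct, Matrix.mulVec_transpose, ← Matrix.dotProduct_mulVec,
    dotProduct_comm (N.RR.mulVec _), dotProduct_comm (N.BB.mulVec _)]
  ring

end Network

/-! ### Equilibria and the static criterion for consensus -/

namespace Network

variable {V : Type*} {r : ℕ} [Fintype V]

/-- The states whose free motion never dissipates energy. -/
def IsUndissipated (N : Network V r) (w : (V × Fin r) ⊕ (N.E × Fin r) → ℝ) : Prop :=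
  ∀ k : ℕ, N.RR.mulVec (N.sysC.mulVec ((N.sysA ^ k).mulVec w)) = 0

theorem IsUndissipated.mulVec {N : Network V r} {w : (V × Fin r) ⊕ (N.E × Fin r) → ℝ}
    (hw : N.IsUndissipated w) : N.IsUndissipated (N.sysA.mulVec w) := fun k => by
  have := hw (k + 1)
  rwa [pow_succ, ← Matrix.mulVec_mulVec] at this

theorem IsUndissipated.RR_mulVec {N : Network V r} {w : (V × Fin r) ⊕ (N.E × Fin r) → ℝ}
    (hw : N.IsUndissipated w) : N.RR.mulVec (N.sysC.mulVec w) = 0 := by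
  simpa using hw 0

/-- In a network with a damped node, an output that is equal on all nodes and lies in the kernel
of the damping vanishes. -/
theorem eq_zero_of_RR_mulVec_of_mem_range (N : Network V r) (hd : ∃ i, N.IsDamped i)
    {y : V × Fin r → ℝ} (hR : N.RR.mulVec y = 0)
    (hy : y ∈ LinearMap.range (stackedId V r).mulVecLin) : y = 0 := by
  obtain ⟨i, hi⟩ := hd
  have : Nonempty V := ⟨i⟩
  exact N.eq_zero_of_BB_transpose_of_apply
    (N.BB_transpose_mulVec_eq_zero_iff.2 (mem_range_stackedId.1 hy))
    (N.apply_eq_zero_of_RR_mulVec hR hi)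

/-- The state operator as a continuous linear map. -/
def stateOp (N : Network V r) :
    ((V × Fin r) ⊕ (N.E × Fin r) → ℝ) →L[ℝ] ((V × Fin r) ⊕ (N.E × Fin r) → ℝ) :=
  LinearMap.toContinuousLinearMap N.sysA.mulVecLin

/-- The output operator as a continuous linear map. -/
def outputOp (N : Network V r) :
    ((V × Fin r) ⊕ (N.E × Fin r) → ℝ) →L[ℝ] (V × Fin r → ℝ) :=
  LinearMap.toContinuousLinearMap N.sysC.mulVecLin

/-- The damping forces as a continuous linear function of the state. -/
def dampingOp (N : Network V r) :
    ((V × Fin r) ⊕ (N.E × Fin r) → ℝ) →L[ℝ] (V × Fin r → ℝ) :=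
  LinearMap.toContinuousLinearMap (N.RR.mulVecLin ∘ₗ N.sysC.mulVecLin)

/-- The energy as a continuous bilinear form. -/
def energyForm (N : Network V r) :
    ((V × Fin r) ⊕ (N.E × Fin r) → ℝ) →L[ℝ] ((V × Fin r) ⊕ (N.E × Fin r) → ℝ) →L[ℝ] ℝ :=
  LinearMap.toContinuousBilinearMap (Matrix.toLinearMap₂' ℝ N.energyMatrix)

@[simp] theorem stateOp_apply (N : Network V r) (w) : N.stateOp w = N.sysA.mulVec w := rfl

@[simp] theorem outputOp_apply (N : Network V r) (w) : N.outputOp w = N.sysC.mulVec w := rfl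

@[simp] theorem dampingOp_apply (N : Network V r) (w) :
    N.dampingOp w = N.RR.mulVec (N.sysC.mulVec w) := rfl

theorem energyForm_apply (N : Network V r) (w w') :
    N.energyForm w w' = w ⬝ᵥ N.energyMatrix.mulVec w' :=
  Matrix.toLinearMap₂'_apply' N.energyMatrix w w'

theorem stateOp_pow_apply (N : Network V r) (k : ℕ) (w) :
    (N.stateOp ^ k) w = (N.sysA ^ k).mulVec w := by
  induction k with
  | zero => simp
  | succ k ih =>
    rw [pow_succ', pow_succ', ← Matrix.mulVec_mulVec, ← ih]
    rfl

theorem isUndissipated_iff (N : Network V r) (w) :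
    N.IsUndissipated w ↔ ∀ k : ℕ, N.dampingOp ((N.stateOp ^ k) w) = 0 := by
  simp only [IsUndissipated, stateOp_pow_apply, dampingOp_apply]

theorem isLyapunovForm (N : Network V r) :
    IsLyapunovForm N.stateOp N.energyForm N.dampingOp where
  symm x y := by
    rw [energyForm_apply, energyForm_apply, ← Sum.elim_comp_inl_inr x, ← Sum.elim_comp_inl_inr y,
      dotProduct_energyMatrix_mulVec, dotProduct_energyMatrix_mulVec,
      N.MM_posDef.inv.isHermitian.dotProduct_mulVec_comm,
      N.WW_posDef.isHermitian.dotProduct_mulVec_comm]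
  pos x hx := by
    rw [energyForm_apply, ← Sum.elim_comp_inl_inr x, dotProduct_energyMatrix_mulVec]
    have h1 := N.MM_posDef.inv.posSemidef.dotProduct_mulVec_nonneg (x ∘ Sum.inl)
    have h2 := N.WW_posDef.posSemidef.dotProduct_mulVec_nonneg (x ∘ Sum.inr)
    rw [star_trivial] at h1 h2
    refine lt_of_le_of_ne (add_nonneg h1 h2) fun h => hx ?_
    obtain ⟨h3, h4⟩ := (add_eq_zero_iff_of_nonneg h1 h2).1 h.symm
    rw [N.MM_posDef.inv.posSemidef.dotProduct_mulVec_eq_zero_iff,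
      N.MM_posDef.inv.mulVec_eq_zero_iff] at h3
    rw [N.WW_posDef.posSemidef.dotProduct_mulVec_eq_zero_iff,
      N.WW_posDef.mulVec_eq_zero_iff] at h4
    rw [← Sum.elim_comp_inl_inr x, h3, h4]
    ext (i | i) <;> rfl
  nonpos x := by
    rw [energyForm_apply, stateOp_apply, ← Sum.elim_comp_inl_inr x, energyMatrix_dissipation,
      neg_nonpos]
    simpa using N.RR_posSemidef.dotProduct_mulVec_nonneg (N.MM⁻¹.mulVec (x ∘ Sum.inl))
  eq_zero_iff x := by
    rw [energyForm_apply, stateOp_apply, dampingOp_apply, ← Sum.elim_comp_inl_inr x,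
      energyMatrix_dissipation, neg_eq_zero, N.RR_posSemidef.dotProduct_mulVec_eq_zero_iff,
      sysC_mulVec]

/-- There is an equilibrium, and its output is equal on all nodes. -/
theorem exists_equilibrium (N : Network V r) (hd : ∃ i, N.IsDamped i) (v : V × Fin r → ℝ) :
    ∃ z, N.sysA.mulVec z + N.sysG.mulVec v = 0 ∧
      N.sysC.mulVec z ∈ LinearMap.range (stackedId V r).mulVecLin := by
  have : Nonempty V := ⟨hd.choose⟩
  obtain ⟨z, hz⟩ := Matrix.exists_mulVec_add_eq_zero N.sysA (N.sysG.mulVec v) fun u hu => by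
    obtain ⟨a, b, rfl⟩ : ∃ a b, u = Sum.elim a b :=
      ⟨_, _, (Sum.elim_comp_inl_inr u).symm⟩
    have hT : N.sysA.transpose.mulVec (Sum.elim a b) =
        Sum.elim (N.MM⁻¹.mulVec (N.BB.mulVec b - N.RR.mulVec a))
          (-(N.WW.mulVec (N.BB.transpose.mulVec a))) := by
      have hM : N.MM⁻¹.transpose = N.MM⁻¹ := N.MM_posDef.inv.isHermitian
      have hR : N.RR.transpose = N.RR := N.RR_posSemidef.isHermitian
      have hW : N.WW.transpose = N.WW := N.WW_posDef.isHermitian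
      simp only [sysA, Matrix.fromBlocks_transpose, Matrix.fromBlocks_mulVec,
        Matrix.transpose_neg, Matrix.transpose_mul, hM, hR, hW, Matrix.transpose_transpose,
        Matrix.transpose_zero, Matrix.zero_mulVec, Matrix.neg_mulVec, ← Matrix.mulVec_mulVec,
        Matrix.mulVec_sub, Sum.elim_comp_inl, Sum.elim_comp_inr, add_zero]
      rw [neg_add_eq_sub]
    rw [hT] at hu
    have h1 : N.MM⁻¹.mulVec (N.BB.mulVec b - N.RR.mulVec a) = 0 :=
      funext fun i => congrFun hu (Sum.inl i)
    have h2 : N.WW.mulVec (N.BB.transpose.mulVec a) = 0 :=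
      neg_eq_zero.1 (funext fun i => congrFun hu (Sum.inr i))
    rw [N.MM_posDef.inv.mulVec_eq_zero_iff, sub_eq_zero] at h1
    rw [N.WW_posDef.mulVec_eq_zero_iff] at h2
    -- Since 𝔹b = Ra and 𝔹ᵀa = 0, aᵀRa = aᵀ𝔹b = 0. Then a is uniform and zero at a damped node, so a
    -- = 0, and the input pairs only with a.
    have h3 : N.RR.mulVec a = 0 := by
      rw [← N.RR_posSemidef.dotProduct_mulVec_eq_zero_iff, ← h1, Matrix.dotProduct_mulVec,
        ← Matrix.mulVec_transpose, h2, zero_dotProduct]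
    obtain ⟨i, hi⟩ := hd
    have h4 := N.eq_zero_of_BB_transpose_of_apply h2 (N.apply_eq_zero_of_RR_mulVec h3 hi)
    rw [sysG_mulVec, h4]
    simp
  refine ⟨z, hz, mem_range_stackedId.2 (N.BB_transpose_mulVec_eq_zero_iff.1 ?_)⟩
  rw [← Sum.elim_comp_inl_inr z, sysA_mulVec, sysG_mulVec] at hz
  rw [← Sum.elim_comp_inl_inr z, sysC_mulVec]
  ext i
  simpa using congrFun hz (Sum.inr i)

theorem isTrajectory_iff (N : Network V r) {v : V × Fin r → ℝ}
    {e : (V × Fin r) ⊕ (N.E × Fin r) → ℝ} (he : N.sysA.mulVec e + N.sysG.mulVec v = 0)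
    {z : ℝ → (V × Fin r) ⊕ (N.E × Fin r) → ℝ} :
    N.IsTrajectory v z ↔ ∃ w, ∀ t, 0 ≤ t → z t = e + linearFlow N.stateOp t w := by
  have key : ∀ x, N.sysA.mulVec x + N.sysG.mulVec v = N.stateOp (x - e) := by
    intro x
    rw [stateOp_apply, Matrix.mulVec_sub, eq_neg_of_add_eq_zero_left he, sub_neg_eq_add]
  constructor
  · intro hz
    refine ⟨z 0 - e, fun t ht => ?_⟩
    have h := eq_linearFlow_of_hasDerivWithinAt N.stateOp (z := fun t => z t - e)
      (fun t ht => by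
        have := (hz t ht).sub_const e
        rwa [key] at this) ht
    rw [← h, add_sub_cancel]
  · rintro ⟨w, hw⟩ t ht
    have h := ((hasDerivAt_linearFlow N.stateOp w t).const_add e).hasDerivWithinAt
      (s := Set.Ici 0)
    rw [key, hw t ht, add_sub_cancel_left]
    exact h.congr hw (hw t ht)

/-- One direction is LaSalle. For the other, consensus forces the output of an undissipated w to
decay; conservation of energy then makes w an equilibrium of the free motion, whose output is
uniform and zero at a damped node. -/
theorem outputConsensus_iff (N : Network V r) (hd : ∃ i, N.IsDamped i) (v : V × Fin r → ℝ) :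
    N.OutputConsensus v ↔ ∀ w, N.IsUndissipated w → N.sysC.mulVec w = 0 := by
  obtain ⟨e, he, hCe⟩ := N.exists_equilibrium hd v
  constructor
  · intro hcons
    have key : ∀ w, N.IsUndissipated w →
        Tendsto (fun t => N.outputOp (linearFlow N.stateOp t w)) atTop (𝓝 0) := by
      intro w hw
      obtain ⟨y, hy, hlim⟩ := hcons _ ((N.isTrajectory_iff he).2 ⟨w, fun t _ => rfl⟩)
      have hlim' : Tendsto (fun t => N.outputOp (linearFlow N.stateOp t w)) atTop
          (𝓝 (y - N.sysC.mulVec e)) := by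
        refine (hlim.sub_const (N.sysC.mulVec e)).congr fun t => ?_
        rw [Matrix.mulVec_add, add_sub_cancel_left, outputOp_apply]
      have hR : N.RR.mulVec (y - N.sysC.mulVec e) = 0 := by
        refine tendsto_nhds_unique
          (((LinearMap.toContinuousLinearMap N.RR.mulVecLin).continuous.tendsto _).comp hlim') ?_
        refine tendsto_const_nhds.congr fun t => ?_
        exact (map_linearFlow_eq_zero N.stateOp N.dampingOp ((N.isUndissipated_iff w).1 hw) t).symm
      rwa [N.eq_zero_of_RR_mulVec_of_mem_range hd hR (Submodule.sub_mem _ hy hCe)] at hlim'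
    intro w hw
    have hw' := hw.mulVec
    -- The output does not control q itself, only q̇ = 𝔹ᵀy. Hence the orbit of Aw, the velocity of
    -- the orbit of w, is the one shown to decay in full.
    have hzero : Tendsto (fun t => linearFlow N.stateOp t (N.stateOp w)) atTop (𝓝 0) := by
      have hp : Tendsto (fun t => N.MM.mulVec (N.sysC.mulVec
          (linearFlow N.stateOp t (N.stateOp w)))) atTop (𝓝 (N.MM.mulVec 0)) :=
        ((LinearMap.toContinuousLinearMap N.MM.mulVecLin).continuous.tendsto _).comp (key _ hw')
      have hq : Tendsto (fun t => N.BB.transpose.mulVec (N.sysC.mulVec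
          (linearFlow N.stateOp t w))) atTop (𝓝 (N.BB.transpose.mulVec 0)) :=
        ((LinearMap.toContinuousLinearMap N.BB.transpose.mulVecLin).continuous.tendsto _).comp
          (key _ hw)
      rw [Matrix.mulVec_zero] at hp hq
      rw [tendsto_pi_nhds] at hp hq ⊢
      rintro (i | i)
      · refine (hp i).congr fun t => ?_
        generalize linearFlow N.stateOp t (N.stateOp w) = x
        rw [← Sum.elim_comp_inl_inr x, sysC_mulVec, Matrix.mulVec_mulVec_inv N.MM_posDef]
        rfl
      · refine (hq i).congr fun t => ?_
        rw [(hasDerivAt_linearFlow' N.stateOp w t).unique (hasDerivAt_linearFlow N.stateOp w t),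
          stateOp_apply]
        generalize linearFlow N.stateOp t w = x
        rw [← Sum.elim_comp_inl_inr x, sysC_mulVec, sysA_mulVec]
        rfl
    -- The energy along the orbit of Aw is both constant and tends to 0.
    have henergy : N.energyForm (N.stateOp w) (N.stateOp w) = 0 := by
      refine tendsto_nhds_unique (f := fun _ : ℝ => _) tendsto_const_nhds
        ((((N.energyForm.continuous.clm_apply continuous_id).tendsto 0).comp hzero).congr
          fun t => N.isLyapunovForm.conserved ((N.isUndissipated_iff _).1 hw') t) |>.trans ?_
      simp
    have hA : N.sysA.mulVec w = 0 := by
      by_contra h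
      exact (N.isLyapunovForm.pos _ h).ne' henergy
    refine N.eq_zero_of_RR_mulVec_of_mem_range hd hw.RR_mulVec ?_
    have : Nonempty V := ⟨hd.choose⟩
    refine mem_range_stackedId.2 (N.BB_transpose_mulVec_eq_zero_iff.1 ?_)
    rw [← Sum.elim_comp_inl_inr w, sysA_mulVec] at hA
    rw [← Sum.elim_comp_inl_inr w, sysC_mulVec]
    exact funext fun i => congrFun hA (Sum.inr i)
  · intro h z hz
    obtain ⟨w, hw⟩ := (N.isTrajectory_iff he).1 hz
    refine ⟨N.sysC.mulVec e, hCe, ?_⟩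
    have h0 := N.isLyapunovForm.tendsto_output_zero N.outputOp
      (fun x hx => h x ((N.isUndissipated_iff x).2 hx)) w
    have h1 := h0.const_add (N.sysC.mulVec e)
    rw [add_zero] at h1
    refine h1.congr' ?_
    filter_upwards [eventually_ge_atTop 0] with t ht
    rw [hw t ht, Matrix.mulVec_add, outputOp_apply]

end Network

/-! ### Splitting the Laplacian into damped and undamped blocks -/

namespace Network

variable {V : Type*} {r : ℕ}

/-- The part of a node vector on the damped nodes. -/
def resD (N : Network V r) (y : V × Fin r → ℝ) : N.Vd × Fin r → ℝ := fun x => y (x.1.1, x.2)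

/-- The part of a node vector on the (partially) undamped nodes. -/
def resU (N : Network V r) (y : V × Fin r → ℝ) : N.Vu × Fin r → ℝ := fun x => y (x.1.1, x.2)

/-- The node vector with given parts on the damped and on the (partially) undamped nodes. -/
def glue (N : Network V r) (a : N.Vd × Fin r → ℝ) (b : N.Vu × Fin r → ℝ) : V × Fin r → ℝ :=
  fun x => if h : N.IsDamped x.1 then a (⟨x.1, h⟩, x.2) else b (⟨x.1, h⟩, x.2)

@[simp] theorem resD_glue (N : Network V r) (a b) : N.resD (N.glue a b) = a := by
  ext ⟨⟨i, hi⟩, j⟩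
  simp [resD, glue, hi]

@[simp] theorem resU_glue (N : Network V r) (a b) : N.resU (N.glue a b) = b := by
  ext ⟨⟨i, hi⟩, j⟩
  simp [resU, glue, hi]

@[simp] theorem resD_zero (N : Network V r) : N.resD 0 = 0 := rfl

@[simp] theorem resU_zero (N : Network V r) : N.resU 0 = 0 := rfl

@[simp] theorem resD_neg (N : Network V r) (y) : N.resD (-y) = -N.resD y := rfl

@[simp] theorem resU_neg (N : Network V r) (y) : N.resU (-y) = -N.resU y := rfl

theorem ext_res (N : Network V r) {y y' : V × Fin r → ℝ} (hd : N.resD y = N.resD y')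
    (hu : N.resU y = N.resU y') : y = y' := by
  ext ⟨i, a⟩
  by_cases hi : N.IsDamped i
  · exact congrFun hd (⟨i, hi⟩, a)
  · exact congrFun hu (⟨i, hi⟩, a)

theorem inc_eq_zero (N : Network V r) {i : V} {k : N.E} (hh : i ≠ N.head k)
    (ht : i ≠ N.tail k) : N.inc i k = 0 := by
  simp [inc, hh, ht]

theorem inc_eq_zero_of_isDamped (N : Network V r) {i : V} {k : N.E} (hi : N.IsDamped i)
    (hh : ¬ N.IsDamped (N.head k)) (ht : ¬ N.IsDamped (N.tail k)) : N.inc i k = 0 :=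
  N.inc_eq_zero (fun h => hh (h ▸ hi)) (fun h => ht (h ▸ hi))

theorem inc_eq_zero_of_not_isDamped (N : Network V r) {i : V} {k : N.E} (hi : ¬ N.IsDamped i)
    (hh : N.IsDamped (N.head k)) (ht : N.IsDamped (N.tail k)) : N.inc i k = 0 :=
  N.inc_eq_zero (fun h => hi (h ▸ hh)) (fun h => hi (h ▸ ht))

theorem sum_subtype_eq_sum_ite {K : Type*} [Fintype K] (P : K → Prop) [DecidablePred P]
    [Fintype {k // P k}] (f : K → ℝ) : ∑ k : {k // P k}, f k = ∑ k, if P k then f k else 0 := by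
  rw [← Finset.sum_filter]
  exact (Finset.sum_subtype _ (by simp) f).symm

/-- One entry formula for the full Laplacian and all its blocks: f and f' select the nodes, g the
edges. -/
theorem incidence_weight_incidence_apply (N : Network V r) {I J K : Type*} [Fintype K]
    (f : I → V) (f' : J → V) (g : K → N.E) (x : I × Fin r) (y : J × Fin r) :
    ((N.inc.submatrix f g ⊗ₖ (1 : Matrix (Fin r) (Fin r) ℝ)) * stackDiag (fun k => N.W (g k)) *
      (N.inc.submatrix f' g ⊗ₖ (1 : Matrix (Fin r) (Fin r) ℝ)).transpose) x y =
      ∑ k, N.inc (f x.1) (g k) * N.W (g k) x.2 y.2 * N.inc (f' y.1) (g k) := by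
  simp only [Matrix.mul_apply, Fintype.sum_prod_type, stackDiag_apply, Matrix.transpose_apply,
    Matrix.kroneckerMap_apply, Matrix.submatrix_apply, Matrix.one_apply]
  simp

variable [Fintype V]

theorem sum_Vd_add_sum_Vu (N : Network V r) (f : V × Fin r → ℝ) :
    (∑ x : N.Vd × Fin r, f (x.1.1, x.2)) + ∑ x : N.Vu × Fin r, f (x.1.1, x.2) = ∑ x, f x := by
  simp only [Fintype.sum_prod_type]
  exact Fintype.sum_subtype_add_sum_subtype N.IsDamped fun i => ∑ a, f (i, a)

theorem dotProduct_eq_res_add_res (N : Network V r) (y y' : V × Fin r → ℝ) :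
    y ⬝ᵥ y' = N.resD y ⬝ᵥ N.resD y' + N.resU y ⬝ᵥ N.resU y' :=
  (N.sum_Vd_add_sum_Vu fun x => y x * y' x).symm

/-- The Laplacian `𝔹 W 𝔹ᵀ` of the whole graph. -/
def LL (N : Network V r) : Matrix (V × Fin r) (V × Fin r) ℝ := N.BB * N.WW * N.BB.transpose

theorem LL_mulVec (N : Network V r) (y : V × Fin r → ℝ) :
    N.LL.mulVec y = N.BB.mulVec (N.WW.mulVec (N.BB.transpose.mulVec y)) := by
  rw [LL, ← Matrix.mulVec_mulVec, ← Matrix.mulVec_mulVec]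

theorem dotProduct_LL_mulVec (N : Network V r) (y : V × Fin r → ℝ) :
    y ⬝ᵥ N.LL.mulVec y = N.BB.transpose.mulVec y ⬝ᵥ N.WW.mulVec (N.BB.transpose.mulVec y) := by
  rw [LL_mulVec, Matrix.dotProduct_mulVec, Matrix.mulVec_transpose]

theorem BB_transpose_mulVec_eq_zero_of_LL (N : Network V r) {y : V × Fin r → ℝ}
    (h : y ⬝ᵥ N.LL.mulVec y = 0) : N.BB.transpose.mulVec y = 0 := by
  rw [dotProduct_LL_mulVec, N.WW_posDef.posSemidef.dotProduct_mulVec_eq_zero_iff,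
    N.WW_posDef.mulVec_eq_zero_iff] at h
  exact h

theorem LL_apply (N : Network V r) (x y : V × Fin r) :
    N.LL x y = ∑ k, N.inc x.1 k * N.W k x.2 y.2 * N.inc y.1 k :=
  N.incidence_weight_incidence_apply id id id x y

theorem LL_isHermitian (N : Network V r) : N.LL.IsHermitian := by
  ext x y
  rw [Matrix.conjTranspose_apply, star_trivial, LL_apply, LL_apply]
  refine Finset.sum_congr rfl fun k _ => ?_
  rw [← (N.W_posDef k).isHermitian.apply x.2 y.2, star_trivial]
  ring

theorem Ldd_apply (N : Network V r) (x : N.Vd × Fin r) (y : N.Vd × Fin r) :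
    N.Ldd x y = ∑ k, if N.IsDamped (N.tail k) ∧ N.IsDamped (N.head k)
      then N.inc x.1 k * N.W k x.2 y.2 * N.inc y.1 k else 0 :=
  (N.incidence_weight_incidence_apply Subtype.val Subtype.val Subtype.val x y).trans
    (sum_subtype_eq_sum_ite _ fun k => N.inc x.1 k * N.W k x.2 y.2 * N.inc y.1 k)

theorem Ldi_apply (N : Network V r) (x : N.Vd × Fin r) (y : N.Vd × Fin r) :
    N.Ldi x y = ∑ k, if ¬ (N.IsDamped (N.tail k) ↔ N.IsDamped (N.head k))
      then N.inc x.1 k * N.W k x.2 y.2 * N.inc y.1 k else 0 :=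
  (N.incidence_weight_incidence_apply Subtype.val Subtype.val Subtype.val x y).trans
    (sum_subtype_eq_sum_ite _ fun k => N.inc x.1 k * N.W k x.2 y.2 * N.inc y.1 k)

theorem Lui_apply (N : Network V r) (x : N.Vu × Fin r) (y : N.Vu × Fin r) :
    N.Lui x y = ∑ k, if ¬ (N.IsDamped (N.tail k) ↔ N.IsDamped (N.head k))
      then N.inc x.1 k * N.W k x.2 y.2 * N.inc y.1 k else 0 :=
  (N.incidence_weight_incidence_apply Subtype.val Subtype.val Subtype.val x y).trans
    (sum_subtype_eq_sum_ite _ fun k => N.inc x.1 k * N.W k x.2 y.2 * N.inc y.1 k)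

theorem Luu_apply (N : Network V r) (x : N.Vu × Fin r) (y : N.Vu × Fin r) :
    N.Luu x y = ∑ k, if ¬ N.IsDamped (N.tail k) ∧ ¬ N.IsDamped (N.head k)
      then N.inc x.1 k * N.W k x.2 y.2 * N.inc y.1 k else 0 :=
  (N.incidence_weight_incidence_apply Subtype.val Subtype.val Subtype.val x y).trans
    (sum_subtype_eq_sum_ite _ fun k => N.inc x.1 k * N.W k x.2 y.2 * N.inc y.1 k)

/-- Edges inside V_u do not touch damped nodes, so the other two classes give the whole block. -/
theorem Ldd_add_Ldi_apply (N : Network V r) (x y : N.Vd × Fin r) :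
    (N.Ldd + N.Ldi) x y = N.LL (x.1.1, x.2) (y.1.1, y.2) := by
  rw [Matrix.add_apply, LL_apply, Ldd_apply, Ldi_apply, ← Finset.sum_add_distrib]
  refine Finset.sum_congr rfl fun k _ => ?_
  by_cases ht : N.IsDamped (N.tail k) <;> by_cases hh : N.IsDamped (N.head k)
  · simp [ht, hh]
  · simp [ht, hh]
  · simp [ht, hh]
  · simp [N.inc_eq_zero_of_isDamped x.1.2 hh ht]

theorem Luu_add_Lui_apply (N : Network V r) (x y : N.Vu × Fin r) :
    (N.Luu + N.Lui) x y = N.LL (x.1.1, x.2) (y.1.1, y.2) := by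
  rw [Matrix.add_apply, LL_apply, Luu_apply, Lui_apply, ← Finset.sum_add_distrib]
  refine Finset.sum_congr rfl fun k _ => ?_
  by_cases ht : N.IsDamped (N.tail k) <;> by_cases hh : N.IsDamped (N.head k)
  · simp [N.inc_eq_zero_of_not_isDamped x.1.2 hh ht]
  · simp [ht, hh]
  · simp [ht, hh]
  · simp [ht, hh]

theorem Lii_apply (N : Network V r) (x : N.Vd × Fin r) (y : N.Vu × Fin r) :
    N.Lii x y = N.LL (x.1.1, x.2) (y.1.1, y.2) := by
  rw [LL_apply]
  refine (N.incidence_weight_incidence_apply Subtype.val Subtype.val Subtype.val x y).trans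
    ((sum_subtype_eq_sum_ite _ fun k => N.inc x.1 k * N.W k x.2 y.2 * N.inc y.1 k).trans ?_)
  refine Finset.sum_congr rfl fun k _ => ?_
  by_cases ht : N.IsDamped (N.tail k) <;> by_cases hh : N.IsDamped (N.head k)
  · simp [N.inc_eq_zero_of_not_isDamped y.1.2 hh ht]
  · simp [ht, hh]
  · simp [ht, hh]
  · simp [N.inc_eq_zero_of_isDamped x.1.2 hh ht]

theorem resD_LL_mulVec (N : Network V r) (y : V × Fin r → ℝ) :
    N.resD (N.LL.mulVec y) = (N.Ldd + N.Ldi).mulVec (N.resD y) + N.Lii.mulVec (N.resU y) := by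
  ext x
  simp only [resD, resU, Pi.add_apply, Matrix.mulVec, dotProduct, Ldd_add_Ldi_apply, Lii_apply]
  exact (N.sum_Vd_add_sum_Vu fun z => N.LL (x.1.1, x.2) z * y z).symm

theorem resU_LL_mulVec (N : Network V r) (y : V × Fin r → ℝ) :
    N.resU (N.LL.mulVec y) =
      N.Lii.transpose.mulVec (N.resD y) + (N.Luu + N.Lui).mulVec (N.resU y) := by
  ext x
  simp only [resD, resU, Pi.add_apply, Matrix.mulVec, dotProduct, Luu_add_Lui_apply,
    Matrix.transpose_apply, Lii_apply]
  rw [← N.sum_Vd_add_sum_Vu]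
  congr 1
  refine Finset.sum_congr rfl fun z _ => ?_
  rw [← N.LL_isHermitian.apply, star_trivial]

/-- Extend x by zero to V_u. If the Laplacian form vanishes there, the extension is uniform, and it
is zero at an undamped node. -/
theorem Ldd_add_Ldi_posDef (N : Network V r) (hu : ∃ i, ¬ N.IsDamped i) :
    (N.Ldd + N.Ldi).PosDef := by
  refine Matrix.PosDef.of_dotProduct_mulVec_pos ?_ fun x hx => ?_
  · ext x y
    rw [Matrix.conjTranspose_apply, Ldd_add_Ldi_apply, Ldd_add_Ldi_apply, N.LL_isHermitian.apply]
  · have h1 : N.glue x 0 ⬝ᵥ N.LL.mulVec (N.glue x 0) = x ⬝ᵥ (N.Ldd + N.Ldi).mulVec x := by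
      rw [dotProduct_eq_res_add_res, resU_glue, zero_dotProduct, add_zero, resD_LL_mulVec,
        resD_glue, resU_glue, Matrix.mulVec_zero, add_zero]
    have h2 : 0 ≤ N.glue x 0 ⬝ᵥ N.LL.mulVec (N.glue x 0) := by
      rw [dotProduct_LL_mulVec]
      simpa using N.WW_posDef.posSemidef.dotProduct_mulVec_nonneg
        (N.BB.transpose.mulVec (N.glue x 0))
    rw [star_trivial, ← h1]
    refine lt_of_le_of_ne h2 fun h => hx ?_
    obtain ⟨i, hi⟩ := hu
    have h3 := N.eq_zero_of_BB_transpose_of_apply (N.BB_transpose_mulVec_eq_zero_of_LL h.symm)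
      (i := i) fun a => congrFun (N.resU_glue x 0) (⟨i, hi⟩, a)
    rw [← N.resD_glue x 0, h3, resD_zero]

/-- Schur complement: the damped displacements are chosen to balance the forces on V_d. -/
theorem LL_mulVec_glue (N : Network V r) (hu : ∃ i, ¬ N.IsDamped i) (s : N.Vu × Fin r → ℝ) :
    N.LL.mulVec (N.glue (-((N.Ldd + N.Ldi)⁻¹.mulVec (N.Lii.mulVec s))) s) =
      N.glue 0 (N.Lred.mulVec s) := by
  apply N.ext_res
  · rw [resD_LL_mulVec, resD_glue, resU_glue, resD_glue, Matrix.mulVec_neg,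
      Matrix.mulVec_mulVec_inv (N.Ldd_add_Ldi_posDef hu), neg_add_cancel]
  · rw [resU_LL_mulVec, resD_glue, resU_glue, resU_glue, Matrix.mulVec_neg, Lred,
      Matrix.sub_mulVec, ← Matrix.mulVec_mulVec, ← Matrix.mulVec_mulVec, neg_add_eq_sub]

theorem resD_stackDiag_mulVec (N : Network V r) (D : V → Matrix (Fin r) (Fin r) ℝ)
    (y : V × Fin r → ℝ) : N.resD ((stackDiag D).mulVec y) =
      (stackDiag fun i : N.Vd => D i).mulVec (N.resD y) := by
  ext ⟨i, a⟩
  rw [stackDiag_mulVec]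
  exact stackDiag_mulVec D y i.1 a

theorem resU_stackDiag_mulVec (N : Network V r) (D : V → Matrix (Fin r) (Fin r) ℝ)
    (y : V × Fin r → ℝ) : N.resU ((stackDiag D).mulVec y) =
      (stackDiag fun i : N.Vu => D i).mulVec (N.resU y) := by
  ext ⟨i, a⟩
  rw [stackDiag_mulVec]
  exact stackDiag_mulVec D y i.1 a

theorem resU_MM_mulVec (N : Network V r) (y : V × Fin r → ℝ) :
    N.resU (N.MM.mulVec y) = N.Mu.mulVec (N.resU y) := N.resU_stackDiag_mulVec N.M y

theorem resU_RR_mulVec (N : Network V r) (y : V × Fin r → ℝ) :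
    N.resU (N.RR.mulVec y) = N.Ru.mulVec (N.resU y) := N.resU_stackDiag_mulVec N.R y

theorem resD_MM_mulVec (N : Network V r) {y : V × Fin r → ℝ} (hy : N.resD y = 0) :
    N.resD (N.MM.mulVec y) = 0 := by
  rw [MM, resD_stackDiag_mulVec, hy, Matrix.mulVec_zero]

theorem MM_mulVec_glue_zero (N : Network V r) (b : N.Vu × Fin r → ℝ) :
    N.MM.mulVec (N.glue 0 b) = N.glue 0 (N.Mu.mulVec b) :=
  N.ext_res (by rw [N.resD_MM_mulVec (N.resD_glue 0 b), resD_glue])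
    (by rw [resU_MM_mulVec, resU_glue, resU_glue])

theorem RR_mulVec_glue_zero (N : Network V r) (b : N.Vu × Fin r → ℝ) :
    N.RR.mulVec (N.glue 0 b) = N.glue 0 (N.Ru.mulVec b) :=
  N.ext_res (by rw [RR, resD_stackDiag_mulVec, resD_glue, resD_glue, Matrix.mulVec_zero])
    (by rw [resU_RR_mulVec, resU_glue, resU_glue])

theorem resD_eq_zero_of_RR_mulVec (N : Network V r) {y : V × Fin r → ℝ}
    (h : N.RR.mulVec y = 0) : N.resD y = 0 :=
  funext fun x => N.apply_eq_zero_of_RR_mulVec h x.1.2 x.2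

/-! ### Undissipated states versus unobservable reduced states -/

theorem Ahat_mulVec (N : Network V r) (y s : N.Vu × Fin r → ℝ) :
    N.Ahat.mulVec (Sum.elim y s) = Sum.elim (-(N.Mu⁻¹.mulVec (N.Lred.mulVec s))) y := by
  simp [Ahat, Matrix.fromBlocks_mulVec, Matrix.neg_mulVec, Matrix.mulVec_mulVec]

theorem Chathat_mulVec_eq_zero_iff (N : Network V r) (y s : N.Vu × Fin r → ℝ) :
    N.Chathat.mulVec (Sum.elim y s) = 0 ↔ N.Lii.mulVec y = 0 ∧ N.Ru.mulVec y = 0 ∧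
      (stackedId N.Vu r).transpose.mulVec (N.Mu.mulVec s) = 0 := by
  have : N.Chathat.mulVec (Sum.elim y s) = Sum.elim (N.Lii.mulVec y) (Sum.elim (N.Ru.mulVec y)
      ((stackedId N.Vu r).transpose.mulVec (N.Mu.mulVec s))) := by
    simp [Chathat, Matrix.fromRows_mulVec, Matrix.fromCols_mulVec, Matrix.fromBlocks_mulVec,
      Matrix.mulVec_mulVec]
  rw [this]
  simp only [funext_iff, Sum.forall, Sum.elim_inl, Sum.elim_inr, Pi.zero_apply]

/-- The states of the reduced system that are unobservable from its output. -/
def IsReducedUnobservable (N : Network V r) (x : (N.Vu × Fin r) ⊕ (N.Vu × Fin r) → ℝ) : Prop :=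
  ∀ k : ℕ, N.Chathat.mulVec ((N.Ahat ^ k).mulVec x) = 0

theorem IsReducedUnobservable.mulVec {N : Network V r}
    {x : (N.Vu × Fin r) ⊕ (N.Vu × Fin r) → ℝ} (hx : N.IsReducedUnobservable x) :
    N.IsReducedUnobservable (N.Ahat.mulVec x) := fun k => by
  have := hx (k + 1)
  rwa [pow_succ, ← Matrix.mulVec_mulVec] at this

/-- The network state whose undamped velocities and displacements are the two parts of `x` and
in which no net force acts on the damped nodes. -/
def liftState (N : Network V r) (x : (N.Vu × Fin r) ⊕ (N.Vu × Fin r) → ℝ) :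
    (V × Fin r) ⊕ (N.E × Fin r) → ℝ :=
  Sum.elim (N.MM.mulVec (N.glue 0 (x ∘ Sum.inl))) (N.BB.transpose.mulVec
    (N.glue (-((N.Ldd + N.Ldi)⁻¹.mulVec (N.Lii.mulVec (x ∘ Sum.inr)))) (x ∘ Sum.inr)))

theorem sysC_mulVec_liftState (N : Network V r) (x) :
    N.sysC.mulVec (N.liftState x) = N.glue 0 (x ∘ Sum.inl) := by
  rw [liftState, sysC_mulVec, Matrix.inv_mulVec_mulVec N.MM_posDef]

theorem IsReducedUnobservable.out {N : Network V r}
    {x : (N.Vu × Fin r) ⊕ (N.Vu × Fin r) → ℝ} (hx : N.IsReducedUnobservable x) :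
    N.Lii.mulVec (x ∘ Sum.inl) = 0 ∧ N.Ru.mulVec (x ∘ Sum.inl) = 0 ∧
      (stackedId N.Vu r).transpose.mulVec (N.Mu.mulVec (x ∘ Sum.inr)) = 0 := by
  rw [← Chathat_mulVec_eq_zero_iff, Sum.elim_comp_inl_inr]
  simpa using hx 0

theorem IsReducedUnobservable.RR_mulVec {N : Network V r}
    {x : (N.Vu × Fin r) ⊕ (N.Vu × Fin r) → ℝ} (hx : N.IsReducedUnobservable x) :
    N.RR.mulVec (N.sysC.mulVec (N.liftState x)) = 0 := by
  rw [sysC_mulVec_liftState, RR_mulVec_glue_zero, hx.out.2.1]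
  exact N.ext_res (by simp) (by simp)

/-- R_u y = 0 removes the damping force, and L_i^i y = 0 keeps the balancing damped displacements
constant, as damped nodes at rest require. -/
theorem IsReducedUnobservable.sysA_mulVec_liftState {N : Network V r}
    (hu : ∃ i, ¬ N.IsDamped i) {x : (N.Vu × Fin r) ⊕ (N.Vu × Fin r) → ℝ}
    (hx : N.IsReducedUnobservable x) :
    N.sysA.mulVec (N.liftState x) = N.liftState (N.Ahat.mulVec x) := by
  obtain ⟨y, s, rfl⟩ : ∃ y s, x = Sum.elim y s := ⟨_, _, (Sum.elim_comp_inl_inr x).symm⟩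
  have hR := hx.RR_mulVec
  have hL : N.Lii.mulVec y = 0 := hx.out.1
  rw [sysC_mulVec_liftState, Sum.elim_comp_inl] at hR
  rw [liftState, sysA_mulVec, Matrix.inv_mulVec_mulVec N.MM_posDef, ← LL_mulVec,
    LL_mulVec_glue N hu, liftState, Ahat_mulVec]
  simp only [Sum.elim_comp_inl, Sum.elim_comp_inr, hR, hL, Matrix.mulVec_zero, neg_zero,
    zero_sub]
  rw [MM_mulVec_glue_zero, Matrix.mulVec_neg, Matrix.mulVec_mulVec_inv N.Mu_posDef]
  congr 1
  exact N.ext_res (by simp) (by simp)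

theorem IsReducedUnobservable.isUndissipated {N : Network V r} (hu : ∃ i, ¬ N.IsDamped i)
    {x : (N.Vu × Fin r) ⊕ (N.Vu × Fin r) → ℝ} (hx : N.IsReducedUnobservable x) :
    N.IsUndissipated (N.liftState x) := by
  intro k
  induction k generalizing x with
  | zero => simpa using hx.RR_mulVec
  | succ k ih =>
    rw [pow_succ, ← Matrix.mulVec_mulVec, hx.sysA_mulVec_liftState hu]
    exact ih hx.mulVec

/-- Lifting x gives y = 0 and lifting Âx gives L̃_u s = 0. Then s extends to a kernel vector of the
Laplacian, so it is uniform, and the third output row kills it. -/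
theorem IsReducedUnobservable.eq_zero {N : Network V r} (hu : ∃ i, ¬ N.IsDamped i)
    (hC : ∀ w, N.IsUndissipated w → N.sysC.mulVec w = 0)
    {x : (N.Vu × Fin r) ⊕ (N.Vu × Fin r) → ℝ} (hx : N.IsReducedUnobservable x) : x = 0 := by
  have key : ∀ {x}, N.IsReducedUnobservable x → x ∘ Sum.inl = 0 := by
    intro x hx
    have h := hC _ (hx.isUndissipated hu)
    rw [sysC_mulVec_liftState] at h
    rw [← N.resU_glue 0 (x ∘ Sum.inl), h, resU_zero]
  obtain ⟨y, s, rfl⟩ : ∃ y s, x = Sum.elim y s := ⟨_, _, (Sum.elim_comp_inl_inr x).symm⟩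
  have hy : y = 0 := key hx
  have hs := key hx.mulVec
  rw [Ahat_mulVec, Sum.elim_comp_inl, neg_eq_zero, N.Mu_posDef.inv.mulVec_eq_zero_iff] at hs
  have hmean : (stackedId N.Vu r).transpose.mulVec (N.Mu.mulVec s) = 0 := hx.out.2.2
  set g := N.glue (-((N.Ldd + N.Ldi)⁻¹.mulVec (N.Lii.mulVec s))) s with hg
  have hLg : N.LL.mulVec g = 0 := by
    rw [hg, LL_mulVec_glue N hu, hs]
    exact N.ext_res (by simp) (by simp)
  have hconst := N.BB_transpose_mulVec_eq_zero_iff.1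
    (N.BB_transpose_mulVec_eq_zero_of_LL (y := g) (by rw [hLg, dotProduct_zero]))
  have : Nonempty N.Vu := ⟨⟨_, hu.choose_spec⟩⟩
  obtain ⟨c, hc⟩ : s ∈ LinearMap.range (stackedId N.Vu r).mulVecLin := by
    refine mem_range_stackedId.2 fun i j a => ?_
    have h := hconst i.1 j.1 a
    rw [← N.resU_glue (-((N.Ldd + N.Ldi)⁻¹.mulVec (N.Lii.mulVec s))) s]
    exact h
  -- With s = 𝕀_r c, sᵀM_u s = cᵀ𝕀_rᵀM_u s = 0.
  have hs0 : s = 0 := by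
    rw [← N.Mu_posDef.mulVec_eq_zero_iff,
      ← N.Mu_posDef.posSemidef.dotProduct_mulVec_eq_zero_iff]
    nth_rewrite 1 [← hc]
    rw [Matrix.mulVecLin_apply, ← Matrix.vecMul_transpose, ← Matrix.dotProduct_mulVec, hmean,
      dotProduct_zero]
  rw [hy, hs0]
  ext (i | i) <;> rfl

theorem IsUndissipated.MM_mulVec_sysC_sysA {N : Network V r}
    {w : (V × Fin r) ⊕ (N.E × Fin r) → ℝ} (hw : N.IsUndissipated w) :
    N.MM.mulVec (N.sysC.mulVec (N.sysA.mulVec w)) =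
      -(N.BB.mulVec (N.WW.mulVec (w ∘ Sum.inr))) := by
  have hR := hw.RR_mulVec
  rw [← Sum.elim_comp_inl_inr w, sysC_mulVec] at hR
  conv_lhs => rw [← Sum.elim_comp_inl_inr w]
  rw [sysA_mulVec, sysC_mulVec, Matrix.mulVec_mulVec_inv N.MM_posDef, hR, neg_zero, zero_sub]

/-- This is Mÿ = -Ly, from Mẏ = -𝔹Wq and q̇ = 𝔹ᵀy. -/
theorem IsUndissipated.MM_mulVec_sysC_sysA_sysA {N : Network V r}
    {w : (V × Fin r) ⊕ (N.E × Fin r) → ℝ} (hw : N.IsUndissipated w) :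
    N.MM.mulVec (N.sysC.mulVec (N.sysA.mulVec (N.sysA.mulVec w))) =
      -(N.LL.mulVec (N.sysC.mulVec w)) := by
  rw [hw.mulVec.MM_mulVec_sysC_sysA, LL_mulVec, ← Sum.elim_comp_inl_inr w, sysC_mulVec,
    sysA_mulVec, Sum.elim_comp_inr]

theorem IsUndissipated.resD_sysC {N : Network V r} {w : (V × Fin r) ⊕ (N.E × Fin r) → ℝ}
    (hw : N.IsUndissipated w) : N.resD (N.sysC.mulVec w) = 0 :=
  N.resD_eq_zero_of_RR_mulVec hw.RR_mulVec

/-- The damped rows of Mÿ = -Ly, where both y and ÿ vanish. -/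
theorem IsUndissipated.Lii_mulVec {N : Network V r} {w : (V × Fin r) ⊕ (N.E × Fin r) → ℝ}
    (hw : N.IsUndissipated w) : N.Lii.mulVec (N.resU (N.sysC.mulVec w)) = 0 := by
  have h := congrArg N.resD hw.MM_mulVec_sysC_sysA_sysA
  rwa [N.resD_MM_mulVec hw.mulVec.mulVec.resD_sysC, resD_neg, resD_LL_mulVec, hw.resD_sysC,
    Matrix.mulVec_zero, zero_add, eq_comm, neg_eq_zero] at h

/-- The undamped rows; the Schur correction in L̃_u costs nothing since L_i^i y_u = 0. -/
theorem IsUndissipated.Mu_mulVec {N : Network V r} {w : (V × Fin r) ⊕ (N.E × Fin r) → ℝ}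
    (hw : N.IsUndissipated w) :
    N.Mu.mulVec (N.resU (N.sysC.mulVec (N.sysA.mulVec (N.sysA.mulVec w)))) =
      -(N.Lred.mulVec (N.resU (N.sysC.mulVec w))) := by
  rw [← resU_MM_mulVec, hw.MM_mulVec_sysC_sysA_sysA, resU_neg, resU_LL_mulVec, hw.resD_sysC,
    Matrix.mulVec_zero, zero_add, Lred, Matrix.sub_mulVec, ← Matrix.mulVec_mulVec,
    hw.Lii_mulVec, Matrix.mulVec_zero, sub_zero]

/-- The state of the reduced system formed by the undamped parts of the acceleration rate and
of the acceleration of the network. -/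
def reducedState (N : Network V r) (w : (V × Fin r) ⊕ (N.E × Fin r) → ℝ) :
    (N.Vu × Fin r) ⊕ (N.Vu × Fin r) → ℝ :=
  Sum.elim (N.resU (N.sysC.mulVec (N.sysA.mulVec (N.sysA.mulVec w))))
    (N.resU (N.sysC.mulVec (N.sysA.mulVec w)))

theorem sum_BB_mulVec (N : Network V r) (q : N.E × Fin r → ℝ) (a : Fin r) :
    ∑ i, N.BB.mulVec q (i, a) = 0 := by
  have h : N.BB.transpose.mulVec (fun x => if x.2 = a then 1 else 0) = 0 :=
    N.BB_transpose_mulVec_eq_zero_iff.2 fun i j b => rfl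
  have h2 : (fun x : V × Fin r => if x.2 = a then (1 : ℝ) else 0) ⬝ᵥ N.BB.mulVec q = 0 := by
    rw [Matrix.dotProduct_mulVec, ← Matrix.mulVec_transpose, h, zero_dotProduct]
  simpa [dotProduct, Fintype.sum_prod_type] using h2

/-- Using ẏ_u as displacement makes the third row automatic: 𝕀_rᵀM_u ẏ_u is the total of the edge
forces -𝔹Wq, because ẏ_d = 0, and these sum to zero. -/
theorem IsUndissipated.Chathat_mulVec_reducedState {N : Network V r}
    {w : (V × Fin r) ⊕ (N.E × Fin r) → ℝ} (hw : N.IsUndissipated w) :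
    N.Chathat.mulVec (N.reducedState w) = 0 := by
  refine (N.Chathat_mulVec_eq_zero_iff _ _).2 ⟨hw.mulVec.mulVec.Lii_mulVec, ?_, ?_⟩
  · rw [← resU_RR_mulVec, hw.mulVec.mulVec.RR_mulVec, resU_zero]
  · ext a
    rw [stackedId_transpose_mulVec, ← resU_MM_mulVec, Pi.zero_apply]
    have hD := N.resD_MM_mulVec hw.mulVec.resD_sysC
    have h := Fintype.sum_subtype_add_sum_subtype N.IsDamped fun i =>
      N.MM.mulVec (N.sysC.mulVec (N.sysA.mulVec w)) (i, a)
    have hzero : ∑ i : N.Vd, N.MM.mulVec (N.sysC.mulVec (N.sysA.mulVec w)) (i, a) = 0 :=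
      Finset.sum_eq_zero fun i _ => congrFun hD (i, a)
    rw [hzero, zero_add] at h
    refine Eq.trans h ?_
    simp only [hw.MM_mulVec_sysC_sysA, Pi.neg_apply, Finset.sum_neg_distrib, sum_BB_mulVec,
      neg_zero]

theorem IsUndissipated.Ahat_mulVec_reducedState {N : Network V r}
    {w : (V × Fin r) ⊕ (N.E × Fin r) → ℝ} (hw : N.IsUndissipated w) :
    N.Ahat.mulVec (N.reducedState w) = N.reducedState (N.sysA.mulVec w) := by
  rw [reducedState, Ahat_mulVec, reducedState, ← Matrix.mulVec_neg, ← hw.mulVec.Mu_mulVec,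
    Matrix.inv_mulVec_mulVec N.Mu_posDef]

theorem IsUndissipated.isReducedUnobservable {N : Network V r}
    {w : (V × Fin r) ⊕ (N.E × Fin r) → ℝ} (hw : N.IsUndissipated w) :
    N.IsReducedUnobservable (N.reducedState w) := by
  intro k
  induction k generalizing w with
  | zero => simpa using hw.Chathat_mulVec_reducedState
  | succ k ih =>
    rw [pow_succ, ← Matrix.mulVec_mulVec, hw.Ahat_mulVec_reducedState]
    exact ih hw.mulVec

/-- Observability gives ÿ = 0, hence Ly = 0; y is then uniform and vanishes at a damped node. -/
theorem IsUndissipated.sysC_mulVec_eq_zero {N : Network V r} (hd : ∃ i, N.IsDamped i)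
    (hobs : ∀ x, N.IsReducedUnobservable x → x = 0)
    {w : (V × Fin r) ⊕ (N.E × Fin r) → ℝ} (hw : N.IsUndissipated w) :
    N.sysC.mulVec w = 0 := by
  have h1 := hobs _ hw.isReducedUnobservable
  have h2 : N.resU (N.sysC.mulVec (N.sysA.mulVec (N.sysA.mulVec w))) = 0 :=
    funext fun i => congrFun h1 (Sum.inl i)
  have h3 : N.sysC.mulVec (N.sysA.mulVec (N.sysA.mulVec w)) = 0 :=
    N.ext_res hw.mulVec.mulVec.resD_sysC h2
  have h4 := hw.MM_mulVec_sysC_sysA_sysA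
  rw [h3, Matrix.mulVec_zero, eq_comm, neg_eq_zero] at h4
  obtain ⟨i, hi⟩ := hd
  exact N.eq_zero_of_BB_transpose_of_apply
    (N.BB_transpose_mulVec_eq_zero_of_LL (by rw [h4, dotProduct_zero]))
    (N.apply_eq_zero_of_RR_mulVec hw.RR_mulVec hi)

end Network

end

theorem mainTheorem2 {V : Type*} [Fintype V] {r : ℕ} (N : Network V r)
    (hd : ∃ i, N.IsDamped i) (hu : ∃ i, ¬ N.IsDamped i) (v : V × Fin r → ℝ) :
    N.OutputConsensus v ↔ LinearMap.ker (obsMatrix N.Chathat N.Ahat).mulVecLin = ⊥ := by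
  rw [N.outputConsensus_iff hd v, ker_obsMatrix_eq_bot_iff]
  exact ⟨fun h _ hx => Network.IsReducedUnobservable.eq_zero hu h hx,
    fun h _ hw => hw.sysC_mulVec_eq_zero hd h⟩
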